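/- Let $r\in(0,\infty)$ be fixed. For $\theta\in\mathbb R^n$ let the past observation $X\sim N_n(\theta,I)$ and the future observation $Y\sim N_n(\theta,rI)$ be independent, and write $p(\cdot\,|\,\theta,r)$ for the Lebesgue density of $Y$. A predictive density estimator is a jointly measurable function $\hat p(y|x)\ge 0$ on $\mathbb R^n\times\mathbb R^n$ with $\int \hat p(y|x)\,dy=1$ for every $x$. Its Kullback-Leibler risk is $$\rho(\theta,\hat p)=E_{X\sim N_n(\theta,I)}\int p(y\,|\,\theta,r)\log\frac{p(y\,|\,\theta,r)}{\hat p(y|X)}\,dy\in[0,\infty].$$ For a set $\Theta\subseteq\mathbb R^n$ put $R_N(\Theta)=\inf_{\hat p}\sup_{\theta\in\Theta}\rho(\theta,\hat p)$, and for a probability measure $\pi$ on $\mathbb R^n$ put $B(\pi)=\inf_{\hat p}\int\rho(\theta,\hat p)\,\pi(d\theta)$, both infima being over all predictive density estimators. Let $\Theta_n[s]$ be the set of $\theta\in\mathbb R^n$ with at most $s$ nonzero coordinates. Let $(s_n)$ be a sequence of non-negative integers with $s_n\ge 1$ for all large $n$. For every $n$ with $s_n\ge1$ and $n\ge 2s_n$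 define the independent blocks prior $\pi_n^{\rm IB}$ on $\mathbb R^n$ as follows. Put $m=\lfloor n/s_n\rfloor$, $v_w=(1+r^{-1})^{-1}$, $\lambda_m=\sqrt{2\log m}$ and $\nu_m=\sqrt{v_w}\,(\lambda_m-\log\lambda_m)$. Divide the first $m s_n$ coordinates into $s_n$ contiguous blocks of length $m$; independently in each block choose one index uniformly at random, set the coordinate at this index equal to $\nu_m$ and the other coordinates of the block equal to $0$; set the remaining $n-ms_n$ coordinates equal to $0$. If $s_n/n\to0$ as $n\to\infty$, then $$R_N(\Theta_n[s_n])\ \ge\ B(\pi_n^{\rm IB})\qquad\text{for every } n \text{ with } s_n\ge 1 \text{ and } n\ge 2s_n,$$ and there is a sequence $\varepsilon_n\to0$ such that, for all sufficiently large $n$, $$B(\pi_n^{\rm IB})\ \ge\ (1-\varepsilon_n)\,\frac{1}{1+r}\,s_n\log\frac{n}{s_n}.$$ -/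

import Mathlib

open MeasureTheory ProbabilityTheory Filter Topology
open scoped NNReal ENNReal

namespace SparsePrediction

/-- The Gaussian law `N_n(θ, v I)` on `ℝⁿ`: the product of the one-dimensional laws
`N(θ_i, v)`. -/
noncomputable def gaussian {n : ℕ} (θ : Fin n → ℝ) (v : ℝ≥0) : Measure (Fin n → ℝ) :=
  Measure.pi fun i => gaussianReal (θ i) v

/-- A measurable predictive density estimator `p̂(y | x)` on `ℝⁿ`: a jointly measurable,
nonnegative function which is, for every past observation `x`, a probability density in the
future observation `y` with respect to Lebesgue measure. -/
structure PredictiveDensity (n : ℕ) where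
  /-- `density x y` is `p̂(y | x)` -/
  density : (Fin n → ℝ) → (Fin n → ℝ) → ℝ≥0
  measurable_density : Measurable (Function.uncurry density)
  lintegral_density : ∀ x, ∫⁻ y, (density x y : ℝ≥0∞) = 1

/-- The probability measure `p̂(y | x) dy`. -/
noncomputable def PredictiveDensity.law {n : ℕ} (p : PredictiveDensity n) (x : Fin n → ℝ) :
    Measure (Fin n → ℝ) :=
  (volume : Measure (Fin n → ℝ)).withDensity fun y => (p.density x y : ℝ≥0∞)

/-- The Kullback-Leibler loss
`L(θ, p̂(· | x)) = ∫ p(y | θ, r) log (p(y | θ, r) / p̂(y | x)) dy ∈ [0, ∞]`, where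
`p(· | θ, r)` is the density of the future observation `Y ∼ N_n(θ, r I)`. -/
noncomputable def loss {n : ℕ} (r : ℝ≥0) (θ : Fin n → ℝ) (p : PredictiveDensity n)
    (x : Fin n → ℝ) : ℝ≥0∞ :=
  InformationTheory.klDiv (gaussian θ r) (p.law x)

/-- The Kullback-Leibler risk `ρ(θ, p̂)`: the expected loss under the past observation
`X ∼ N_n(θ, I)`. -/
noncomputable def risk {n : ℕ} (r : ℝ≥0) (θ : Fin n → ℝ) (p : PredictiveDensity n) : ℝ≥0∞ :=
  ∫⁻ x, loss r θ p x ∂(gaussian θ 1)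

/-- The integrated risk `B(π, p̂) = ∫ ρ(θ, p̂) π(dθ)`. -/
noncomputable def integratedRisk {n : ℕ} (r : ℝ≥0) (π : Measure (Fin n → ℝ))
    (p : PredictiveDensity n) : ℝ≥0∞ :=
  ∫⁻ θ, risk r θ p ∂π

/-- The Bayes risk `B(π) = inf_{p̂} B(π, p̂)`. -/
noncomputable def bayesRisk {n : ℕ} (r : ℝ≥0) (π : Measure (Fin n → ℝ)) : ℝ≥0∞ :=
  ⨅ p : PredictiveDensity n, integratedRisk r π p

/-- The minimax risk `R_N(Θ) = inf_{p̂} sup_{θ ∈ Θ} ρ(θ, p̂)`. -/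
noncomputable def minimaxRisk {n : ℕ} (r : ℝ≥0) (Θ : Set (Fin n → ℝ)) : ℝ≥0∞ :=
  ⨅ p : PredictiveDensity n, ⨆ θ ∈ Θ, risk r θ p

/-- The sparse parameter space `Θ_n[s]` of vectors in `ℝⁿ` with at most `s` nonzero
coordinates. -/
def sparseSet (n s : ℕ) : Set (Fin n → ℝ) := {θ | hammingNorm θ ≤ s}

/-- The single spike prior `π_S(τ; m)` on `ℝᵐ`: the law of `τ e_I` with `I` uniformly
distributed on the `m` indices. -/
noncomputable def spikePrior (τ : ℝ) (m : ℕ) : Measure (Fin m → ℝ) :=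
  (m : ℝ≥0∞)⁻¹ • ∑ i : Fin m, Measure.dirac (Pi.single i τ)

/-- Place `s` vectors of length `m` one after the other in the first `s m` coordinates of `ℝⁿ`
(so the `j`-th contiguous block of length `m` is the `j`-th vector) and set the remaining
coordinates equal to zero. -/
def concatBlocks (n s m : ℕ) (f : Fin s → Fin m → ℝ) : Fin n → ℝ := fun i =>
  if h : (i : ℕ) < s * m then
    f (finProdFinEquiv.symm ⟨i, h⟩).1 (finProdFinEquiv.symm ⟨i, h⟩).2
  else 0

/-- The oracle variance `v_w = (1 + r⁻¹)⁻¹`. -/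
noncomputable def oracleVar (r : ℝ≥0) : ℝ := (1 + (r : ℝ)⁻¹)⁻¹

/-- `λ_m = √(2 log m)`. -/
noncomputable def lam (m : ℕ) : ℝ := Real.sqrt (2 * Real.log m)

/-- The spike scale `ν_m = √v_w (λ_m - log λ_m)`; it is used for `m ≥ 2`, where `λ_m > 0`. -/
noncomputable def spikeScale (r : ℝ≥0) (m : ℕ) : ℝ :=
  Real.sqrt (oracleVar r) * (lam m - Real.log (lam m))

/-- The independent blocks prior on `ℝⁿ`: with `m = ⌊n / s⌋`, the coordinates in each of `s`
contiguous blocks of length `m` are drawn according to independent copies of `π_S(ν_m; m)`,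
and the remaining `n - m s` coordinates are zero. -/
noncomputable def blocksPrior (r : ℝ≥0) (n s : ℕ) : Measure (Fin n → ℝ) :=
  (Measure.pi fun _ : Fin s => spikePrior (spikeScale r (n / s)) (n / s)).map
    (concatBlocks n s (n / s))

end SparsePrediction

/-! The minimax claim holds because the prior is carried by `s`-sparse vectors. For the asymptotic
claim the Bayes predictive density is never computed; a dual bound replaces it. Young's inequality
gives KL(P, Q) ≥ 1 + ∫ g dP - ∫ e^g dQ for any integrable test function g. Take one g_J for each
spike pattern J, and let L_J be the likelihood ratio of N(θ_J, I) to N(0, I). If the average over J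
of L_J(x) e^{g_J(x, y)} is at most 1 pointwise, the exponential terms cost at most 1 on average,
whatever the estimator, so a common lower bound on the means of the g_J bounds the average risk
(`ofReal_average_le_average_risk`).

The ideal g_J is log(p(y|θ_J)/p(y|0)) minus the log of the average joint likelihood ratio of (x, y);
it meets the constraint with equality and is a sum over blocks. In each block that log average is
replaced by an explicit upper bound: the spike's share is controlled by ν times noise because
ν²(1+1/r)/2 ≤ log m, and the null coordinates' share has mean at most 1 (`exp_add_blockTest_le`,
`le_integral_blockTest`). A block thus yields ν²/(2r) - O(ν) - 1, which is equivalent to log m/(1+r)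
since ν² ~ 2r log m/(1+r); finally log m ~ log(n/s). -/

namespace SparsePrediction

/-! ### Likelihood ratios of Gaussian product laws. -/

/-- A finite product of measures with densities is the product measure with the product
density. -/
lemma pi_withDensity_eq {ι : Type*} [Fintype ι] {X : ι → Type*} [∀ i, MeasurableSpace (X i)]
    (μ : ∀ i, Measure (X i)) [∀ i, IsProbabilityMeasure (μ i)] (f : ∀ i, X i → ℝ≥0∞)
    (hf : ∀ i, Measurable (f i)) [∀ i, SigmaFinite ((μ i).withDensity (f i))] :
    Measure.pi (fun i => (μ i).withDensity (f i)) =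
      (Measure.pi μ).withDensity (fun x => ∏ i, f i (x i)) := by
  classical
  refine (Measure.pi_eq fun s hs => ?_)
  rw [withDensity_apply _ (MeasurableSet.univ_pi hs), ← lintegral_indicator (MeasurableSet.univ_pi hs)]
  have h1 : ∀ x : ∀ i, X i, (Set.univ.pi s).indicator (fun x => ∏ i, f i (x i)) x =
      ∏ i, (s i).indicator (f i) (x i) := by
    intro x
    by_cases hx : x ∈ Set.univ.pi s
    · rw [Set.indicator_of_mem hx]
      exact Finset.prod_congr rfl fun i _ => (Set.indicator_of_mem (hx i trivial) _).symm
    · rw [Set.indicator_of_notMem hx]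
      simp only [Set.mem_univ_pi, not_forall] at hx
      obtain ⟨i, hi⟩ := hx
      exact (Finset.prod_eq_zero (Finset.mem_univ i) (Set.indicator_of_notMem hi _)).symm
  simp_rw [h1]
  have hm : ∀ i, Measurable ((s i).indicator (f i)) := fun i => (hf i).indicator (hs i)
  have := lintegral_prod_eq_prod_lintegral_of_indepFun (μ := Measure.pi μ) Finset.univ
    (fun i (x : ∀ i, X i) => (s i).indicator (f i) (x i))
    (iIndepFun_pi (μ := μ) (X := fun i => (s i).indicator (f i)) fun i => (hm i).aemeasurable)
    (fun i => (hm i).comp (measurable_pi_apply i))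
  rw [this]
  refine Finset.prod_congr rfl fun i _ => ?_
  rw [(measurePreserving_eval μ i).lintegral_comp (hm i), lintegral_indicator (hs i),
    withDensity_apply _ (hs i)]

lemma gaussianReal_eq_withDensity_standard (t : ℝ) :
    gaussianReal t 1 =
      (gaussianReal 0 1).withDensity fun x => ENNReal.ofReal (Real.exp (t * x - t ^ 2 / 2)) := by
  rw [gaussianReal_of_var_ne_zero t one_ne_zero, gaussianReal_of_var_ne_zero 0 one_ne_zero,
    ← withDensity_mul _ (measurable_gaussianPDF 0 1) (by fun_prop)]
  congr 1
  ext x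
  simp only [gaussianPDF, Pi.mul_apply, gaussianPDFReal]
  rw [← ENNReal.ofReal_mul (by positivity), mul_assoc (√_)⁻¹, ← Real.exp_add]
  congr 3
  simp
  ring

/-- The likelihood ratio of `N(θ, I)` with respect to `N(0, I)`. -/
lemma gaussian_eq_withDensity_standard {n : ℕ} (θ : Fin n → ℝ) :
    gaussian θ 1 = (gaussian 0 1).withDensity fun x =>
      ENNReal.ofReal (Real.exp (∑ i, (θ i * x i - θ i ^ 2 / 2))) := by
  have h : ∀ i, SigmaFinite ((gaussianReal 0 1).withDensity
      fun x => ENNReal.ofReal (Real.exp (θ i * x - θ i ^ 2 / 2))) := by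
    intro i
    rw [← gaussianReal_eq_withDensity_standard]
    infer_instance
  unfold gaussian
  simp_rw [fun i => gaussianReal_eq_withDensity_standard (θ i)]
  rw [pi_withDensity_eq (fun _ : Fin n => gaussianReal 0 1) _ (fun i => by fun_prop)]
  congr 1
  ext x
  rw [Real.exp_sum, ENNReal.ofReal_prod_of_nonneg fun i _ => (Real.exp_pos _).le]

instance {n : ℕ} (θ : Fin n → ℝ) (v : ℝ≥0) : IsProbabilityMeasure (gaussian θ v) := by
  unfold gaussian; infer_instance

/-! ### Duality lower bound for the average risk. -/

/-- Young's inequality for the function `klFun` and its convex conjugate. -/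
lemma mul_add_one_le_klFun_add_exp {f : ℝ} (hf : 0 ≤ f) (g : ℝ) :
    1 + f * g ≤ InformationTheory.klFun f + Real.exp g := by
  rw [InformationTheory.klFun_apply]
  rcases hf.eq_or_lt with rfl | hf
  · simp [Real.exp_nonneg]
  -- This is e^u ≥ u + 1 at u = g - log f, multiplied by f.
  · have h := Real.add_one_le_exp (g - Real.log f)
    rw [Real.exp_sub, Real.exp_log hf, le_div_iff₀ hf] at h
    linarith

/-- A variational lower bound for the Kullback-Leibler divergence. -/
lemma one_add_lintegral_le_klDiv_add {α : Type*} [MeasurableSpace α] (P Q : Measure α)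
    [IsProbabilityMeasure P] [IsProbabilityMeasure Q] {g : α → ℝ} (hg : Measurable g) :
    1 + ∫⁻ y, ENNReal.ofReal (g y) ∂P ≤
      InformationTheory.klDiv P Q + ∫⁻ y, ENNReal.ofReal (Real.exp (g y)) ∂Q +
        ∫⁻ y, ENNReal.ofReal (-g y) ∂P := by
  by_cases hPQ : P ≪ Q
  swap
  · rw [InformationTheory.klDiv_of_not_ac hPQ]; simp
  have hd := Measure.measurable_rnDeriv P Q
  have hk := InformationTheory.measurable_klFun
  rw [InformationTheory.klDiv_eq_lintegral_klFun_of_ac hPQ]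
  rw [← lintegral_rnDeriv_mul hPQ (f := fun y => ENNReal.ofReal (g y)) (by fun_prop),
    ← lintegral_rnDeriv_mul hPQ (f := fun y => ENNReal.ofReal (-g y)) (by fun_prop)]
  have h1 : (1 : ℝ≥0∞) = ∫⁻ _, 1 ∂Q := by simp
  rw [h1, ← lintegral_add_left (by fun_prop), ← lintegral_add_left (by fun_prop),
    ← lintegral_add_left (by fun_prop)]
  refine lintegral_mono_ae ?_
  filter_upwards [Measure.rnDeriv_lt_top P Q] with y hy
  set f := P.rnDeriv Q y
  have hf : f = ENNReal.ofReal f.toReal := (ENNReal.ofReal_toReal hy.ne).symm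
  have h0 : 0 ≤ f.toReal := ENNReal.toReal_nonneg
  have hY := mul_add_one_le_klFun_add_exp h0 (g y)
  have hK := InformationTheory.klFun_nonneg h0
  generalize f.toReal = a at *
  rw [hf, ← ENNReal.ofReal_mul h0, ← ENNReal.ofReal_mul h0, ← ENNReal.ofReal_add hK (Real.exp_nonneg _)]
  -- The positive and negative parts of g stand on opposite sides, which avoids subtraction in
  -- `ℝ≥0∞`; at each point only one of them is nonzero.
  rcases le_total 0 (g y) with h | h
  · rw [← ENNReal.ofReal_one, ← ENNReal.ofReal_add zero_le_one (by positivity)]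
    exact (ENNReal.ofReal_le_ofReal hY).trans le_self_add
  · rw [ENNReal.ofReal_of_nonpos (mul_nonpos_of_nonneg_of_nonpos h0 h), add_zero,
      ← ENNReal.ofReal_one, ← ENNReal.ofReal_add (by positivity)
      (mul_nonneg h0 (neg_nonneg.2 h))]
    exact ENNReal.ofReal_le_ofReal (by linarith)

instance {n : ℕ} (p : PredictiveDensity n) (x : Fin n → ℝ) : IsProbabilityMeasure (p.law x) := by
  refine ⟨?_⟩
  rw [PredictiveDensity.law, withDensity_apply _ MeasurableSet.univ, setLIntegral_univ,
    p.lintegral_density]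

lemma PredictiveDensity.lintegral_law {n : ℕ} (p : PredictiveDensity n) (x : Fin n → ℝ)
    {f : (Fin n → ℝ) → ℝ≥0∞} (hf : Measurable f) :
    ∫⁻ y, f y ∂(p.law x) = ∫⁻ y, p.density x y * f y := by
  have := p.measurable_density
  rw [PredictiveDensity.law, lintegral_withDensity_eq_lintegral_mul _ (by fun_prop) hf]
  rfl

lemma PredictiveDensity.measurable_lintegral_law {n : ℕ} (p : PredictiveDensity n)
    {f : (Fin n → ℝ) × (Fin n → ℝ) → ℝ≥0∞} (hf : Measurable f) :
    Measurable fun x => ∫⁻ y, f (x, y) ∂(p.law x) := by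
  have h := p.measurable_density
  simp_rw [fun x => p.lintegral_law x (f := fun y => f (x, y)) (by fun_prop)]
  refine Measurable.lintegral_prod_right' (f := fun z => (p.density z.1 z.2 : ℝ≥0∞) * f z) ?_
  exact (measurable_coe_nnreal_ennreal.comp h).mul hf

/-- Lower bound for the risk by a test function `g`. -/
lemma one_add_lintegral_le_risk_add {n : ℕ} (r : ℝ≥0) (θ : Fin n → ℝ) (p : PredictiveDensity n)
    {g : (Fin n → ℝ) × (Fin n → ℝ) → ℝ} (hg : Measurable g) :
    1 + ∫⁻ z, ENNReal.ofReal (g z) ∂((gaussian θ 1).prod (gaussian θ r)) ≤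
      risk r θ p +
        ∫⁻ x, ∫⁻ y, ENNReal.ofReal (Real.exp (g (x, y))) ∂(p.law x) ∂(gaussian θ 1) +
        ∫⁻ z, ENNReal.ofReal (-g z) ∂((gaussian θ 1).prod (gaussian θ r)) := by
  have h1 : (1 : ℝ≥0∞) = ∫⁻ _, 1 ∂(gaussian θ 1) := by simp
  have hm := p.measurable_lintegral_law (f := fun z => ENNReal.ofReal (Real.exp (g z)))
    (by fun_prop)
  have hm' : Measurable fun x => ∫⁻ y, ENNReal.ofReal (-g (x, y)) ∂(gaussian θ r) :=
    Measurable.lintegral_prod_right' (f := fun z => ENNReal.ofReal (-g z)) (by fun_prop)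
  rw [lintegral_prod _ (by fun_prop), lintegral_prod _ (by fun_prop), risk, h1,
    ← lintegral_add_left measurable_const, ← lintegral_add_right _ hm,
    ← lintegral_add_right _ hm']
  exact lintegral_mono fun x =>
    one_add_lintegral_le_klDiv_add (gaussian θ r) (p.law x) (g := fun y => g (x, y)) (by fun_prop)

/-- Lower bound for the average risk over finitely many parameters by test functions `g k`
which satisfy an exponential constraint. -/
lemma ofReal_average_le_average_risk {n : ℕ} {ι : Type*} [Fintype ι] (r : ℝ≥0) (c : ℝ≥0)
    (hc : c * Fintype.card ι = 1)
    (θ : ι → Fin n → ℝ) (p : PredictiveDensity n) {g : ι → (Fin n → ℝ) × (Fin n → ℝ) → ℝ}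
    (hg : ∀ k, Measurable (g k))
    (hint : ∀ k, Integrable (g k) ((gaussian (θ k) 1).prod (gaussian (θ k) r)))
    (hexp : ∀ x y, ∑ k, (c : ℝ) * Real.exp (∑ i, (θ k i * x i - θ k i ^ 2 / 2) + g k (x, y)) ≤ 1)
    {A : ℝ} (hA : ∀ k, A ≤ ∫ z, g k z ∂((gaussian (θ k) 1).prod (gaussian (θ k) r))) :
    ENNReal.ofReal A ≤ c * ∑ k, risk r (θ k) p := by
  set μ : ι → Measure ((Fin n → ℝ) × (Fin n → ℝ)) :=
    fun k => (gaussian (θ k) 1).prod (gaussian (θ k) r) with hμ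
  have hcE : ∑ _k : ι, (c : ℝ≥0∞) = 1 := by
    rw [Finset.sum_const, Finset.card_univ, nsmul_eq_mul, mul_comm]
    exact_mod_cast hc
  have hcR : ∑ _k : ι, (c : ℝ) = 1 := by
    rw [Finset.sum_const, Finset.card_univ, nsmul_eq_mul, mul_comm]
    exact_mod_cast hc
  have hconstraint : ∑ k, (c : ℝ≥0∞) *
      ∫⁻ x, ∫⁻ y, ENNReal.ofReal (Real.exp (g k (x, y))) ∂(p.law x) ∂(gaussian (θ k) 1) ≤ 1 := by
    have hm : ∀ k, Measurable fun x => ∫⁻ y, ENNReal.ofReal (Real.exp (g k (x, y))) ∂(p.law x) :=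
      fun k => p.measurable_lintegral_law (f := fun z => ENNReal.ofReal (Real.exp (g k z)))
        (by have := hg k; fun_prop)
    -- Changing measure to N(0, I) gives all k the same outer law, so the sum over k can be moved
    -- inside and bounded pointwise by `hexp`.
    simp_rw [fun k => gaussian_eq_withDensity_standard (θ k)]
    have h2 : ∀ k, (c : ℝ≥0∞) *
        ∫⁻ x, ∫⁻ y, ENNReal.ofReal (Real.exp (g k (x, y))) ∂(p.law x)
          ∂((gaussian 0 1).withDensity fun x =>
            ENNReal.ofReal (Real.exp (∑ i, (θ k i * x i - θ k i ^ 2 / 2)))) =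
        ∫⁻ x, ∫⁻ y, ENNReal.ofReal
          (c * Real.exp (∑ i, (θ k i * x i - θ k i ^ 2 / 2) + g k (x, y))) ∂(p.law x)
          ∂(gaussian 0 1) := by
      intro k
      have := hg k
      rw [lintegral_withDensity_eq_lintegral_mul _ (by fun_prop) (hm k),
        ← lintegral_const_mul _ (Measurable.mul (by fun_prop) (hm k))]
      refine lintegral_congr fun x => ?_
      rw [Pi.mul_apply, ← lintegral_const_mul _ (by fun_prop),
        ← lintegral_const_mul _ (by fun_prop)]
      refine lintegral_congr fun y => ?_
      rw [Real.exp_add, ENNReal.ofReal_mul (by positivity), ENNReal.ofReal_mul (by positivity),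
        ENNReal.ofReal_coe_nnreal]
    simp_rw [h2]
    rw [← lintegral_finsetSum]
    swap
    · intro k _
      have := hg k
      exact p.measurable_lintegral_law (f := fun z => ENNReal.ofReal
          (c * Real.exp (∑ i, (θ k i * z.1 i - θ k i ^ 2 / 2) + g k z))) (by fun_prop)
    have h3 : ∀ x, ∑ k, ∫⁻ y, ENNReal.ofReal
          (c * Real.exp (∑ i, (θ k i * x i - θ k i ^ 2 / 2) + g k (x, y))) ∂(p.law x) ≤ 1 := by
      intro x
      rw [← lintegral_finsetSum _ fun k _ => by have := hg k; fun_prop]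
      calc _ ≤ ∫⁻ _, 1 ∂(p.law x) := by
            refine lintegral_mono fun y => ?_
            rw [← ENNReal.ofReal_sum_of_nonneg fun k _ => by positivity, ← ENNReal.ofReal_one]
            exact ENNReal.ofReal_le_ofReal (hexp x y)
        _ = 1 := by simp
    calc _ ≤ ∫⁻ _, 1 ∂(gaussian 0 1) := lintegral_mono h3
      _ = 1 := by simp
  have hpos : ∀ k, ∫⁻ z, ENNReal.ofReal (g k z) ∂(μ k) ≠ ∞ := fun k =>
    (hint k).lintegral_lt_top.ne
  have hneg : ∀ k, ∫⁻ z, ENNReal.ofReal (-g k z) ∂(μ k) ≠ ∞ := fun k =>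
    (hint k).neg.lintegral_lt_top.ne
  have hsum : 1 + ∑ k, (c : ℝ≥0∞) * ∫⁻ z, ENNReal.ofReal (g k z) ∂(μ k) ≤
      1 + (c * ∑ k, risk r (θ k) p + ∑ k, (c : ℝ≥0∞) * ∫⁻ z, ENNReal.ofReal (-g k z) ∂(μ k)) := by
    calc _ = ∑ k, (c : ℝ≥0∞) * (1 + ∫⁻ z, ENNReal.ofReal (g k z) ∂(μ k)) := by
          simp_rw [mul_add, mul_one]
          rw [Finset.sum_add_distrib, hcE]
      _ ≤ ∑ k, (c : ℝ≥0∞) * (risk r (θ k) p +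
            ∫⁻ x, ∫⁻ y, ENNReal.ofReal (Real.exp (g k (x, y))) ∂(p.law x) ∂(gaussian (θ k) 1) +
            ∫⁻ z, ENNReal.ofReal (-g k z) ∂(μ k)) := by
          refine Finset.sum_le_sum fun k _ => mul_le_mul_right ?_ _
          exact one_add_lintegral_le_risk_add r (θ k) p (hg k)
      _ ≤ _ := by
          simp_rw [mul_add]
          rw [Finset.sum_add_distrib, Finset.sum_add_distrib, Finset.mul_sum, ← add_assoc,
            add_comm (1 : ℝ≥0∞)]
          gcongr
  have hsum' := (ENNReal.add_le_add_iff_left ENNReal.one_ne_top).1 hsum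
  by_cases htop : c * ∑ k, risk r (θ k) p = ∞
  · rw [htop]; exact le_top
  have hnegtop : ∑ k, (c : ℝ≥0∞) * ∫⁻ z, ENNReal.ofReal (-g k z) ∂(μ k) ≠ ∞ :=
    ENNReal.sum_ne_top.2 fun k _ => ENNReal.mul_ne_top ENNReal.coe_ne_top (hneg k)
  refine ENNReal.ofReal_le_of_le_toReal ?_
  have hR := ENNReal.toReal_mono (ENNReal.add_ne_top.2 ⟨htop, hnegtop⟩) hsum'
  rw [ENNReal.toReal_add htop hnegtop,
    ENNReal.toReal_sum fun k _ => ENNReal.mul_ne_top ENNReal.coe_ne_top (hpos k),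
    ENNReal.toReal_sum fun k _ => ENNReal.mul_ne_top ENNReal.coe_ne_top (hneg k)] at hR
  simp_rw [ENNReal.toReal_mul, ENNReal.coe_toReal] at hR
  have hAsum : A ≤ ∑ k, (c : ℝ) * ∫ z, g k z ∂(μ k) := by
    calc A = ∑ _k : ι, (c : ℝ) * A := by rw [← Finset.sum_mul, hcR, one_mul]
      _ ≤ _ := by
        gcongr with k
        exact hA k
  have hI : ∀ k, ∫ z, g k z ∂(μ k) = _ := fun k =>
    integral_eq_lintegral_pos_part_sub_lintegral_neg_part (hint k)
  simp_rw [hI, mul_sub, Finset.sum_sub_distrib] at hAsum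

  rw [ENNReal.toReal_mul, ENNReal.coe_toReal]
  linarith

/-! ### Moments of single Gaussian coordinates. -/

section Expectations

variable {n : ℕ}

lemma measurePreserving_fst_eval (θ : Fin n → ℝ) (v w : ℝ≥0) (i : Fin n) :
    MeasurePreserving (fun z : (Fin n → ℝ) × (Fin n → ℝ) => z.1 i)
      ((gaussian θ v).prod (gaussian θ w)) (gaussianReal (θ i) v) :=
  (measurePreserving_eval (fun i => gaussianReal (θ i) v) i).comp measurePreserving_fst

lemma measurePreserving_snd_eval (θ : Fin n → ℝ) (v w : ℝ≥0) (i : Fin n) :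
    MeasurePreserving (fun z : (Fin n → ℝ) × (Fin n → ℝ) => z.2 i)
      ((gaussian θ v).prod (gaussian θ w)) (gaussianReal (θ i) w) :=
  (measurePreserving_eval (fun i => gaussianReal (θ i) w) i).comp measurePreserving_snd

lemma integrable_sub_mean_gaussianReal (t : ℝ) (v : ℝ≥0) :
    Integrable (fun x => x - t) (gaussianReal t v) :=
  ((memLp_id_gaussianReal 1).integrable le_rfl).sub (integrable_const t)

lemma integral_abs_sub_mean_gaussianReal_le (t : ℝ) (v : ℝ≥0) :
    ∫ x, |x - t| ∂(gaussianReal t v) ≤ (1 + v) / 2 := by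
  have hv := variance_fun_id_gaussianReal (μ := t) (v := v)
  rw [variance_eq_integral (by fun_prop), integral_id_gaussianReal] at hv
  have hsq : Integrable (fun x => (x - t) ^ 2) (gaussianReal t v) :=
    ((memLp_id_gaussianReal 2).sub (memLp_const t)).integrable_sq
  calc ∫ x, |x - t| ∂(gaussianReal t v) ≤ ∫ x, (1 + (x - t) ^ 2) / 2 ∂(gaussianReal t v) := by
        refine integral_mono (integrable_sub_mean_gaussianReal t v).abs
          (((integrable_const 1).add hsq).div_const 2) fun x => ?_
        have := sq_nonneg (|x - t| - 1)
        rw [sub_sq, sq_abs] at this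
        simp only
        linarith
    _ = (1 + v) / 2 := by
        rw [integral_div, integral_add (integrable_const 1) hsq, hv]
        simp

lemma integral_exp_mul_gaussianReal_zero (v : ℝ≥0) (t : ℝ) :
    ∫ x, Real.exp (t * x) ∂(gaussianReal 0 v) = Real.exp (v * t ^ 2 / 2) := by
  have := congrFun (mgf_fun_id_gaussianReal (μ := 0) (v := v)) t
  simpa [mgf] using this

/-- The likelihood ratio between a spike of height `ν` and zero, in one coordinate `(u, w)` of
the pair of the past and the future observation. -/
noncomputable def spikeLikelihood (r : ℝ≥0) (ν u w : ℝ) : ℝ :=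
  Real.exp ((ν * u - ν ^ 2 / 2) + (ν * w / r - ν ^ 2 / (2 * r)))

lemma spikeLikelihood_pos (r : ℝ≥0) (ν u w : ℝ) : 0 < spikeLikelihood r ν u w := Real.exp_pos _

@[fun_prop]
lemma measurable_spikeLikelihood (r : ℝ≥0) (ν : ℝ) (i j : Fin n) :
    Measurable fun z : (Fin n → ℝ) × (Fin n → ℝ) => spikeLikelihood r ν (z.1 i) (z.2 j) := by
  unfold spikeLikelihood; fun_prop

lemma spikeLikelihood_eq_mul (r : ℝ≥0) (ν u w : ℝ) :
    spikeLikelihood r ν u w =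
      (Real.exp (ν * u) * Real.exp (ν / r * w)) * Real.exp (-(ν ^ 2 / 2 + ν ^ 2 / (2 * r))) := by
  rw [spikeLikelihood, ← Real.exp_add, ← Real.exp_add]
  congr 1
  ring

lemma integrable_spikeLikelihood (r : ℝ≥0) (ν : ℝ) (θ : Fin n → ℝ) (i : Fin n) :
    Integrable (fun z : (Fin n → ℝ) × (Fin n → ℝ) => spikeLikelihood r ν (z.1 i) (z.2 i))
      ((gaussian θ 1).prod (gaussian θ r)) := by
  simp_rw [spikeLikelihood_eq_mul]
  refine Integrable.mul_const ?_ _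
  exact Integrable.mul_prod
    (integrable_comp_eval (X := fun _ : Fin n => ℝ) (f := fun u => Real.exp (ν * u))
      (integrable_exp_mul_gaussianReal ν))
    (integrable_comp_eval (X := fun _ : Fin n => ℝ) (f := fun u => Real.exp (ν / r * u))
      (integrable_exp_mul_gaussianReal (ν / r)))

/-- At a null coordinate the Gaussian moment generating functions cancel the normalization exactly.
This keeps the noise term of a block bounded. -/
lemma integral_spikeLikelihood {r : ℝ≥0} (hr : 0 < r) (ν : ℝ) {θ : Fin n → ℝ} {i : Fin n}
    (hi : θ i = 0) :
    ∫ z : (Fin n → ℝ) × (Fin n → ℝ), spikeLikelihood r ν (z.1 i) (z.2 i)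
      ∂((gaussian θ 1).prod (gaussian θ r)) = 1 := by
  have hr' : (0 : ℝ) < r := hr
  simp_rw [spikeLikelihood_eq_mul]
  rw [integral_mul_const, integral_prod_mul (fun x : Fin n → ℝ => Real.exp (ν * x i))
    (fun y : Fin n → ℝ => Real.exp (ν / r * y i)), gaussian, gaussian,
    integral_comp_eval (X := fun _ : Fin n => ℝ) (f := fun u => Real.exp (ν * u)) (by fun_prop),
    integral_comp_eval (X := fun _ : Fin n => ℝ) (f := fun u => Real.exp (ν / r * u)) (by fun_prop), hi,
    integral_exp_mul_gaussianReal_zero, integral_exp_mul_gaussianReal_zero, ← Real.exp_add,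
    ← Real.exp_add, Real.exp_eq_one_iff]
  push_cast
  field_simp
  ring

end Expectations

/-! ### The test function of one block. -/

section Block

variable {n m : ℕ}

/-- The contribution to the test function of a block with coordinates `c` and a spike of height
`ν` at its index `k`. -/
noncomputable def blockTest (r : ℝ≥0) (ν : ℝ) (c : Fin m → Fin n) (k : Fin m)
    (z : (Fin n → ℝ) × (Fin n → ℝ)) : ℝ :=
  ν * z.2 (c k) / r - ν ^ 2 / (2 * r) -
    (ν * |z.1 (c k) - ν| + ν * |z.2 (c k) - ν| / r +
      (m : ℝ)⁻¹ * ∑ i ∈ Finset.univ.erase k, spikeLikelihood r ν (z.1 (c i)) (z.2 (c i)))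

@[fun_prop]
lemma measurable_blockTest (r : ℝ≥0) (ν : ℝ) (c : Fin m → Fin n) (k : Fin m) :
    Measurable (blockTest r ν c k) := by
  unfold blockTest
  have : Measurable fun z : (Fin n → ℝ) × (Fin n → ℝ) =>
      ∑ i ∈ Finset.univ.erase k, spikeLikelihood r ν (z.1 (c i)) (z.2 (c i)) :=
    Finset.measurable_sum _ fun i _ => by fun_prop
  fun_prop

/-- The right side is what the ideal test function would give. `blockTest` instead subtracts an
upper bound t + b for the log of the average likelihood: t dominates the log of the spike's share,
and b is the null coordinates' share itself. Both have means that are easy to bound. -/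
lemma exp_add_blockTest_le {r : ℝ≥0} (hr : 0 < r) {ν : ℝ} (hν : 0 ≤ ν) (hm : 0 < m)
    (hνm : ν ^ 2 * (1 + (r : ℝ)⁻¹) / 2 ≤ Real.log m) (c : Fin m → Fin n) (k : Fin m)
    (z : (Fin n → ℝ) × (Fin n → ℝ)) :
    Real.exp (ν * z.1 (c k) - ν ^ 2 / 2 + blockTest r ν c k z) ≤
      spikeLikelihood r ν (z.1 (c k)) (z.2 (c k)) /
        ((m : ℝ)⁻¹ * ∑ i, spikeLikelihood r ν (z.1 (c i)) (z.2 (c i))) := by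
  have hr' : (0 : ℝ) < r := hr
  have hm' : (0 : ℝ) < m := by exact_mod_cast hm
  set t := ν * |z.1 (c k) - ν| + ν * |z.2 (c k) - ν| / r with ht
  set b := (m : ℝ)⁻¹ * ∑ i ∈ Finset.univ.erase k, spikeLikelihood r ν (z.1 (c i)) (z.2 (c i))
    with hb
  have ht0 : 0 ≤ t := by positivity
  have hb0 : 0 ≤ b :=
    mul_nonneg (by positivity) (Finset.sum_nonneg fun i _ => (spikeLikelihood_pos _ _ _ _).le)
  have hsplit : (m : ℝ)⁻¹ * ∑ i, spikeLikelihood r ν (z.1 (c i)) (z.2 (c i)) =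
      (m : ℝ)⁻¹ * spikeLikelihood r ν (z.1 (c k)) (z.2 (c k)) + b := by
    rw [hb, ← Finset.add_sum_erase _ _ (Finset.mem_univ k), mul_add]
  have hspike : (m : ℝ)⁻¹ * spikeLikelihood r ν (z.1 (c k)) (z.2 (c k)) ≤ Real.exp t := by
    rw [← Real.exp_log hm', ← Real.exp_neg, spikeLikelihood, ← Real.exp_add, Real.exp_le_exp]
    have h1 : ν * (z.1 (c k) - ν) ≤ ν * |z.1 (c k) - ν| :=
      mul_le_mul_of_nonneg_left (le_abs_self _) hν
    have h2 : ν * (z.2 (c k) - ν) / r ≤ ν * |z.2 (c k) - ν| / r :=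
      div_le_div_of_nonneg_right (mul_le_mul_of_nonneg_left (le_abs_self _) hν) hr'.le
    -- Centring both observations at ν leaves the constant that the factor 1/m absorbs through
    -- `hνm`.
    have h3 : ν * z.1 (c k) - ν ^ 2 / 2 + (ν * z.2 (c k) / r - ν ^ 2 / (2 * r)) =
        ν * (z.1 (c k) - ν) + ν * (z.2 (c k) - ν) / r + ν ^ 2 * (1 + (r : ℝ)⁻¹) / 2 := by
      field_simp
      ring
    rw [h3]
    linarith
  have havg : (m : ℝ)⁻¹ * ∑ i, spikeLikelihood r ν (z.1 (c i)) (z.2 (c i)) ≤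
      Real.exp (t + b) := by
    rw [hsplit, Real.exp_add]
    -- Since e^t ≥ 1, e^t + b ≤ e^t (1 + b) ≤ e^(t + b).
    have h1 := Real.add_one_le_exp b
    have h2 := Real.one_le_exp ht0
    nlinarith
  have hpos : 0 < (m : ℝ)⁻¹ * ∑ i, spikeLikelihood r ν (z.1 (c i)) (z.2 (c i)) := by
    rw [hsplit]
    have := spikeLikelihood_pos r ν (z.1 (c k)) (z.2 (c k))
    positivity
  have heq : Real.exp (ν * z.1 (c k) - ν ^ 2 / 2 + blockTest r ν c k z) =
      spikeLikelihood r ν (z.1 (c k)) (z.2 (c k)) / Real.exp (t + b) := by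
    rw [spikeLikelihood, ← Real.exp_sub, blockTest]
    congr 1
    rw [ht, hb]
    ring
  rw [heq]
  exact div_le_div_of_nonneg_left (spikeLikelihood_pos _ _ _ _).le hpos havg

variable (r : ℝ≥0) (ν : ℝ) (c : Fin m → Fin n) (k : Fin m) {θ : Fin n → ℝ}

lemma integrable_fst_abs_sub (hk : θ (c k) = ν) :
    Integrable (fun z : (Fin n → ℝ) × (Fin n → ℝ) => |z.1 (c k) - ν|)
      ((gaussian θ 1).prod (gaussian θ r)) := by
  refine ((measurePreserving_fst_eval θ 1 r (c k)).integrable_comp_of_integrable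
    (g := fun u => |u - ν|) ?_)
  rw [hk]
  exact (integrable_sub_mean_gaussianReal ν 1).abs

lemma integrable_snd_abs_sub (hk : θ (c k) = ν) :
    Integrable (fun z : (Fin n → ℝ) × (Fin n → ℝ) => |z.2 (c k) - ν|)
      ((gaussian θ 1).prod (gaussian θ r)) := by
  refine ((measurePreserving_snd_eval θ 1 r (c k)).integrable_comp_of_integrable
    (g := fun u => |u - ν|) ?_)
  rw [hk]
  exact (integrable_sub_mean_gaussianReal ν r).abs

lemma integrable_snd_eval (i : Fin n) :
    Integrable (fun z : (Fin n → ℝ) × (Fin n → ℝ) => z.2 i)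
      ((gaussian θ 1).prod (gaussian θ r)) :=
  (measurePreserving_snd_eval θ 1 r i).integrable_comp_of_integrable
    (g := id) ((memLp_id_gaussianReal 1).integrable le_rfl)

lemma integrable_sum_spikeLikelihood (S : Finset (Fin m)) :
    Integrable (fun z : (Fin n → ℝ) × (Fin n → ℝ) =>
      ∑ i ∈ S, spikeLikelihood r ν (z.1 (c i)) (z.2 (c i)))
      ((gaussian θ 1).prod (gaussian θ r)) :=
  integrable_finsetSum _ fun i _ => integrable_spikeLikelihood r ν θ (c i)

lemma integrable_blockTest (hk : θ (c k) = ν) :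
    Integrable (blockTest r ν c k) ((gaussian θ 1).prod (gaussian θ r)) :=
  ((((integrable_snd_eval r (c k)).const_mul ν).div_const r).sub (integrable_const _)).sub
    ((((integrable_fst_abs_sub r ν c k hk).const_mul ν).add
      (((integrable_snd_abs_sub r ν c k hk).const_mul ν).div_const r)).add
      ((integrable_sum_spikeLikelihood r ν c _).const_mul _))

/-- The linear term has mean ν²/(2r); the subtracted terms are the bounds for the two absolute
deviations and for the at most m null likelihood ratios of mean 1, divided by m. -/
lemma le_integral_blockTest {r : ℝ≥0} (hr : 0 < r) {ν : ℝ} (hν : 0 ≤ ν) (hk : θ (c k) = ν)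
    (hi : ∀ i, i ≠ k → θ (c i) = 0) :
    ν ^ 2 / (2 * r) - ν - ν * ((1 + r) / 2) / r - 1 ≤
      ∫ z, blockTest r ν c k z ∂((gaussian θ 1).prod (gaussian θ r)) := by
  have hr' : (0 : ℝ) < r := hr
  have I1 := ((integrable_snd_eval r (θ := θ) (c k)).const_mul ν).div_const (r : ℝ)
  have I2 := (integrable_fst_abs_sub r ν c k hk).const_mul ν
  have I3 := ((integrable_snd_abs_sub r ν c k hk).const_mul ν).div_const (r : ℝ)
  have I4 := (integrable_sum_spikeLikelihood r ν c (θ := θ) (Finset.univ.erase k)).const_mul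
    (m : ℝ)⁻¹
  have e1 : ∫ z : (Fin n → ℝ) × (Fin n → ℝ), z.2 (c k) ∂((gaussian θ 1).prod (gaussian θ r)) =
      ν := by
    have h := integral_map (μ := (gaussian θ 1).prod (gaussian θ r))
      (φ := fun z => z.2 (c k)) (f := fun u => u) (by fun_prop) (by fun_prop)
    rw [← h, (measurePreserving_snd_eval θ 1 r (c k)).map_eq, integral_id_gaussianReal, hk]
  have e2 : ∫ z : (Fin n → ℝ) × (Fin n → ℝ), |z.1 (c k) - ν|
      ∂((gaussian θ 1).prod (gaussian θ r)) ≤ 1 := by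
    have h := integral_map (μ := (gaussian θ 1).prod (gaussian θ r))
      (φ := fun z => z.1 (c k)) (f := fun u => |u - ν|) (by fun_prop) (by fun_prop)
    rw [← h, (measurePreserving_fst_eval θ 1 r (c k)).map_eq, hk]
    refine (integral_abs_sub_mean_gaussianReal_le ν 1).trans (by norm_num)
  have e3 : ∫ z : (Fin n → ℝ) × (Fin n → ℝ), |z.2 (c k) - ν|
      ∂((gaussian θ 1).prod (gaussian θ r)) ≤ (1 + r) / 2 := by
    have h := integral_map (μ := (gaussian θ 1).prod (gaussian θ r))
      (φ := fun z => z.2 (c k)) (f := fun u => |u - ν|) (by fun_prop) (by fun_prop)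
    rw [← h, (measurePreserving_snd_eval θ 1 r (c k)).map_eq, hk]
    exact integral_abs_sub_mean_gaussianReal_le ν r
  have e4 : (m : ℝ)⁻¹ * ∫ z : (Fin n → ℝ) × (Fin n → ℝ),
      ∑ i ∈ Finset.univ.erase k, spikeLikelihood r ν (z.1 (c i)) (z.2 (c i))
      ∂((gaussian θ 1).prod (gaussian θ r)) ≤ 1 := by
    rw [integral_finsetSum _ fun i _ => integrable_spikeLikelihood r ν θ (c i),
      Finset.sum_congr rfl fun i h =>
        integral_spikeLikelihood hr ν (hi i (Finset.ne_of_mem_erase h))]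
    rw [Finset.sum_const, nsmul_eq_mul, mul_one]
    refine (mul_le_mul_of_nonneg_left (b := ((Finset.univ.erase k).card : ℝ)) (c := (m : ℝ)) ?_
      (by positivity)).trans (inv_mul_le_one)
    exact_mod_cast (Finset.card_le_univ _).trans_eq (Fintype.card_fin m)
  have I5 : Integrable (fun z : (Fin n → ℝ) × (Fin n → ℝ) =>
      ν * z.2 (c k) / r - ν ^ 2 / (2 * r)) ((gaussian θ 1).prod (gaussian θ r)) :=
    I1.sub (integrable_const _)
  have I6 : Integrable (fun z : (Fin n → ℝ) × (Fin n → ℝ) =>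
      ν * |z.1 (c k) - ν| + ν * |z.2 (c k) - ν| / r) ((gaussian θ 1).prod (gaussian θ r)) :=
    I2.add I3
  have I7 : Integrable (fun z : (Fin n → ℝ) × (Fin n → ℝ) =>
      ν * |z.1 (c k) - ν| + ν * |z.2 (c k) - ν| / r + (m : ℝ)⁻¹ *
        ∑ i ∈ Finset.univ.erase k, spikeLikelihood r ν (z.1 (c i)) (z.2 (c i)))
      ((gaussian θ 1).prod (gaussian θ r)) :=
    I6.add I4
  unfold blockTest
  rw [integral_sub I5 I7, integral_sub I1 (integrable_const _), integral_add I6 I4,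
    integral_add I2 I3, integral_const, probReal_univ, one_smul]
  simp only [integral_div, integral_const_mul]
  rw [e1]
  have f2 := mul_le_mul_of_nonneg_left e2 hν
  have f3 := div_le_div_of_nonneg_right (mul_le_mul_of_nonneg_left e3 hν) hr'.le
  have f1 : ν * ν / r = ν ^ 2 / (2 * r) + ν ^ 2 / (2 * r) := by field_simp; ring
  linarith

end Block

/-! ### The blocks prior as a uniform mixture, and its Bayes risk. -/

section Prior

/-- The position in `ℝⁿ` of the `i`-th coordinate of the `j`-th block. -/
def blockIndex {n s m : ℕ} (h : s * m ≤ n) (j : Fin s) (i : Fin m) : Fin n :=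
  Fin.castLE h (finProdFinEquiv (j, i))

/-- The vector with a spike of height `ν` at index `J j` of each block `j`. -/
noncomputable def blockSpikes (n : ℕ) {s m : ℕ} (ν : ℝ) (J : Fin s → Fin m) : Fin n → ℝ :=
  concatBlocks n s m fun j => Pi.single (J j) ν

variable {n s m : ℕ}

lemma concatBlocks_blockIndex (h : s * m ≤ n) (f : Fin s → Fin m → ℝ) (j : Fin s) (i : Fin m) :
    concatBlocks n s m f (blockIndex h j i) = f j i := by
  have hlt : ((blockIndex h j i : Fin n) : ℕ) < s * m := (finProdFinEquiv (j, i)).isLt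
  have he : (⟨(blockIndex h j i : Fin n), hlt⟩ : Fin (s * m)) = finProdFinEquiv (j, i) := rfl
  rw [concatBlocks, dif_pos hlt, he, Equiv.symm_apply_apply]

lemma blockIndex_injective (h : s * m ≤ n) :
    Function.Injective fun p : Fin s × Fin m => blockIndex h p.1 p.2 :=
  (Fin.castLE_injective h).comp finProdFinEquiv.injective

lemma concatBlocks_eq_zero (h : s * m ≤ n) (f : Fin s → Fin m → ℝ) {i : Fin n}
    (hi : i ∉ Set.range fun p : Fin s × Fin m => blockIndex h p.1 p.2) :
    concatBlocks n s m f i = 0 := by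
  rw [concatBlocks, dif_neg]
  intro hlt
  refine hi ⟨finProdFinEquiv.symm ⟨i, hlt⟩, ?_⟩
  simp only [blockIndex, Prod.mk.eta, Equiv.apply_symm_apply]
  rfl

lemma blockSpikes_blockIndex_self (h : s * m ≤ n) (ν : ℝ) (J : Fin s → Fin m) (j : Fin s) :
    blockSpikes n ν J (blockIndex h j (J j)) = ν := by
  rw [blockSpikes, concatBlocks_blockIndex, Pi.single_eq_same]

lemma blockSpikes_blockIndex_of_ne (h : s * m ≤ n) (ν : ℝ) (J : Fin s → Fin m) (j : Fin s)
    {i : Fin m} (hi : i ≠ J j) : blockSpikes n ν J (blockIndex h j i) = 0 := by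
  rw [blockSpikes, concatBlocks_blockIndex, Pi.single_eq_of_ne hi]

/-- Applied to F i t = t x_i - t²/2, this splits the log-likelihood ratio into one term per block.
-/
lemma sum_blockSpikes (h : s * m ≤ n) (ν : ℝ) (J : Fin s → Fin m) (F : Fin n → ℝ → ℝ)
    (hF : ∀ i, F i 0 = 0) :
    ∑ i, F i (blockSpikes n ν J i) = ∑ j, F (blockIndex h j (J j)) ν := by
  have h1 : ∑ p : Fin s × Fin m, F (blockIndex h p.1 p.2) (blockSpikes n ν J (blockIndex h p.1 p.2))
      = ∑ i, F i (blockSpikes n ν J i) :=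
    Fintype.sum_of_injective _ (blockIndex_injective h) _ _
      (fun i hi => by rw [blockSpikes, concatBlocks_eq_zero h _ hi, hF]) fun _ => rfl
  rw [← h1, Fintype.sum_prod_type]
  refine Finset.sum_congr rfl fun j _ => ?_
  rw [Finset.sum_eq_single (J j), blockSpikes_blockIndex_self]
  · intro i _ hi
    rw [blockSpikes_blockIndex_of_ne h ν J j hi, hF]
  · simp

lemma blockSpikes_mem_sparseSet (h : s * m ≤ n) (ν : ℝ) (J : Fin s → Fin m) :
    blockSpikes n ν J ∈ sparseSet n s := by
  classical
  have hsub : (Finset.univ.filter fun i => blockSpikes n ν J i ≠ 0) ⊆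
      Finset.univ.image fun j => blockIndex h j (J j) := by
    intro i hi
    rw [Finset.mem_filter] at hi
    have hi' : i ∈ Set.range fun p : Fin s × Fin m => blockIndex h p.1 p.2 := by
      by_contra hcon
      exact hi.2 (concatBlocks_eq_zero h _ hcon)
    obtain ⟨⟨j, k⟩, rfl⟩ := hi'
    have hk : k = J j := by
      by_contra hcon
      exact hi.2 (blockSpikes_blockIndex_of_ne h ν J j hcon)
    subst hk
    exact Finset.mem_image_of_mem _ (Finset.mem_univ j)
  calc hammingNorm (blockSpikes n ν J) ≤ _ := Finset.card_le_card hsub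
    _ ≤ s := Finset.card_image_le.trans_eq (by simp)

lemma measurable_concatBlocks : Measurable (concatBlocks n s m) := by
  refine measurable_pi_lambda _ fun i => ?_
  unfold concatBlocks
  split_ifs with h
  · fun_prop
  · fun_prop

lemma isFiniteMeasure_spikePrior (τ : ℝ) (hm : m ≠ 0) : IsFiniteMeasure (spikePrior τ m) := by
  refine ⟨?_⟩
  have : (m : ℝ≥0∞) ≠ 0 := by exact_mod_cast hm
  simp [spikePrior, ENNReal.inv_mul_cancel this]

lemma pi_spikePrior (τ : ℝ) (hm : m ≠ 0) :
    Measure.pi (fun _ : Fin s => spikePrior τ m) =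
      ((m : ℝ≥0∞)⁻¹ ^ s) • ∑ J : Fin s → Fin m, Measure.dirac fun j => Pi.single (J j) τ := by
  have := isFiniteMeasure_spikePrior τ hm
  refine Measure.pi_eq fun S hS => ?_
  have h1 : ∀ J : Fin s → Fin m,
      Measure.dirac (fun j => (Pi.single (J j) τ : Fin m → ℝ)) (Set.univ.pi S) =
        ∏ j, Measure.dirac (Pi.single (J j) τ : Fin m → ℝ) (S j) := by
    intro J
    rw [Measure.dirac_apply]
    simp_rw [Measure.dirac_apply]
    by_cases hJ : ∀ j, (Pi.single (J j) τ : Fin m → ℝ) ∈ S j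
    · rw [Set.indicator_of_mem (Set.mem_univ_pi.2 hJ)]
      exact (Finset.prod_eq_one fun j _ => Set.indicator_of_mem (hJ j) _).symm
    · rw [Set.indicator_of_notMem (mt Set.mem_univ_pi.1 hJ)]
      obtain ⟨j, hj⟩ := not_forall.1 hJ
      exact (Finset.prod_eq_zero (Finset.mem_univ j) (Set.indicator_of_notMem hj _)).symm
  rw [Measure.smul_apply, Measure.finsetSum_apply]
  simp_rw [h1]
  rw [smul_eq_mul, ← Fintype.piFinset_univ, ← Finset.prod_univ_sum
    (fun _ : Fin s => (Finset.univ : Finset (Fin m)))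
    (fun j i => Measure.dirac (Pi.single i τ : Fin m → ℝ) (S j))]
  simp only [spikePrior, Measure.smul_apply, Measure.finsetSum_apply, smul_eq_mul]
  rw [Finset.prod_mul_distrib]
  simp

lemma lintegral_map_concatBlocks_pi_spikePrior (τ : ℝ) (hm : m ≠ 0) (f : (Fin n → ℝ) → ℝ≥0∞) :
    ∫⁻ θ, f θ ∂((Measure.pi fun _ : Fin s => spikePrior τ m).map (concatBlocks n s m)) =
      ((m : ℝ≥0∞)⁻¹ ^ s) * ∑ J : Fin s → Fin m, f (blockSpikes n τ J) := by
  rw [pi_spikePrior τ hm, Measure.map_smul,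
    Measure.map_finset_sum measurable_concatBlocks.aemeasurable]
  simp_rw [Measure.map_dirac' measurable_concatBlocks]
  rw [lintegral_smul_measure, lintegral_finsetSum_measure]
  simp_rw [lintegral_dirac]
  rfl

lemma integratedRisk_blocksPrior (r : ℝ≥0) (hm : n / s ≠ 0) (p : PredictiveDensity n) :
    integratedRisk r (blocksPrior r n s) p =
      (((n / s : ℕ) : ℝ≥0∞)⁻¹ ^ s) * ∑ J : Fin s → Fin (n / s),
        risk r (blockSpikes n (spikeScale r (n / s)) J) p :=
  lintegral_map_concatBlocks_pi_spikePrior _ hm _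

lemma bayesRisk_blocksPrior_le_minimaxRisk (r : ℝ≥0) (hm : n / s ≠ 0) :
    bayesRisk r (blocksPrior r n s) ≤ minimaxRisk r (sparseSet n s) := by
  refine iInf_mono fun p => ?_
  rw [integratedRisk_blocksPrior r hm]
  have hm' : ((n / s : ℕ) : ℝ≥0∞) ≠ 0 := by exact_mod_cast hm
  calc _ ≤ (((n / s : ℕ) : ℝ≥0∞)⁻¹ ^ s) * ∑ _J : Fin s → Fin (n / s),
        ⨆ θ ∈ sparseSet n s, risk r θ p := by
        gcongr with J
        exact le_iSup₂_of_le _ (blockSpikes_mem_sparseSet (Nat.mul_div_le n s) _ J) le_rfl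
    _ = _ := by
        rw [Finset.sum_const, Finset.card_univ, Fintype.card_fun, Fintype.card_fin,
          Fintype.card_fin, nsmul_eq_mul, ← mul_assoc, Nat.cast_pow, ← mul_pow,
          ENNReal.inv_mul_cancel hm' (by finiteness), one_pow, one_mul]

/-- The exponential constraint for the sum of the block test functions. -/
lemma sum_exp_blockTest_le_one {r : ℝ≥0} (hr : 0 < r) {ν : ℝ} (hν : 0 ≤ ν) (hm : 0 < m)
    (hνm : ν ^ 2 * (1 + (r : ℝ)⁻¹) / 2 ≤ Real.log m) (h : s * m ≤ n) (x y : Fin n → ℝ) :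
    ∑ J : Fin s → Fin m, (((m : ℝ≥0)⁻¹ ^ s : ℝ≥0) : ℝ) *
      Real.exp (∑ i, (blockSpikes n ν J i * x i - blockSpikes n ν J i ^ 2 / 2) +
        ∑ j, blockTest r ν (blockIndex h j) (J j) (x, y)) ≤ 1 := by
  have hm' : (0 : ℝ) < m := by exact_mod_cast hm
  have : NeZero m := ⟨hm.ne'⟩
  set q : Fin s → Fin m → ℝ := fun j i =>
    spikeLikelihood r ν (x (blockIndex h j i)) (y (blockIndex h j i)) with hq
  have hqpos : ∀ j i, 0 < q j i := fun j i => spikeLikelihood_pos _ _ _ _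
  have hS : ∀ j, 0 < ∑ i, q j i := fun j =>
    Finset.sum_pos (fun i _ => hqpos j i) Finset.univ_nonempty
  have hterm : ∀ J : Fin s → Fin m, (((m : ℝ≥0)⁻¹ ^ s : ℝ≥0) : ℝ) *
      Real.exp (∑ i, (blockSpikes n ν J i * x i - blockSpikes n ν J i ^ 2 / 2) +
        ∑ j, blockTest r ν (blockIndex h j) (J j) (x, y)) ≤ ∏ j, q j (J j) / ∑ i, q j i := by
    intro J
    rw [sum_blockSpikes h ν J (fun i t => t * x i - t ^ 2 / 2) (by simp),
      ← Finset.sum_add_distrib, Real.exp_sum]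
    have hc : (((m : ℝ≥0)⁻¹ ^ s : ℝ≥0) : ℝ) = ∏ _j : Fin s, (m : ℝ)⁻¹ := by simp
    rw [hc, ← Finset.prod_mul_distrib]
    refine Finset.prod_le_prod (fun j _ => by positivity) fun j _ => ?_
    refine (mul_le_mul_of_nonneg_left
      (exp_add_blockTest_le hr hν hm hνm (blockIndex h j) (J j) (x, y)) (by positivity)).trans_eq ?_
    have := (hS j).ne'
    simp only [hq] at this ⊢
    field_simp
  calc _ ≤ ∑ J : Fin s → Fin m, ∏ j, q j (J j) / ∑ i, q j i :=
        Finset.sum_le_sum fun J _ => hterm J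
    -- Summing over all patterns factorizes into blocks; in each block the normalized likelihoods
    -- are posterior weights of total mass 1.
    _ = ∏ j, ∑ k, q j k / ∑ i, q j i := by
        rw [Finset.prod_univ_sum, Fintype.piFinset_univ]
    _ = 1 := Finset.prod_eq_one fun j _ => by
        rw [← Finset.sum_div, div_self (hS j).ne']

/-- A nonasymptotic lower bound for the Bayes risk of the independent blocks prior. -/
lemma le_bayesRisk_blocksPrior {r : ℝ≥0} (hr : 0 < r) (hm : n / s ≠ 0)
    (hν : 0 ≤ spikeScale r (n / s))
    (hνm : spikeScale r (n / s) ^ 2 * (1 + (r : ℝ)⁻¹) / 2 ≤ Real.log (n / s : ℕ)) :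
    ENNReal.ofReal (s * (spikeScale r (n / s) ^ 2 / (2 * r) - spikeScale r (n / s) -
      spikeScale r (n / s) * ((1 + r) / 2) / r - 1)) ≤ bayesRisk r (blocksPrior r n s) := by
  have h : s * (n / s) ≤ n := Nat.mul_div_le n s
  set m := n / s with hmdef
  set ν := spikeScale r m
  refine le_iInf fun p => ?_
  have hR := integratedRisk_blocksPrior (s := s) r hm p
  have hc : (((m : ℝ≥0)⁻¹ ^ s : ℝ≥0) : ℝ≥0∞) = (m : ℝ≥0∞)⁻¹ ^ s := by
    have : (m : ℝ≥0) ≠ 0 := by exact_mod_cast hm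
    push_cast [ENNReal.coe_inv this]
    rfl
  rw [hR, ← hmdef, ← hc]
  refine ofReal_average_le_average_risk r ((m : ℝ≥0)⁻¹ ^ s) ?_ (fun J => blockSpikes n ν J) p
    (g := fun J z => ∑ j, blockTest r ν (blockIndex h j) (J j) z) ?_ ?_ ?_ ?_
  · have : (m : ℝ≥0) ≠ 0 := by exact_mod_cast hm
    rw [Fintype.card_fun, Fintype.card_fin, Fintype.card_fin, Nat.cast_pow, ← mul_pow,
      inv_mul_cancel₀ this, one_pow]
  · intro J
    exact Finset.measurable_sum _ fun j _ => by fun_prop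
  · intro J
    exact integrable_finsetSum _ fun j _ => integrable_blockTest r ν _ _
      (blockSpikes_blockIndex_self h ν J j)
  · intro x y
    exact sum_exp_blockTest_le_one hr hν (Nat.pos_of_ne_zero hm) hνm h x y
  · intro J
    rw [integral_finsetSum _ fun j _ => integrable_blockTest r ν _ _
      (blockSpikes_blockIndex_self h ν J j)]
    calc _ = ∑ _j : Fin s, (ν ^ 2 / (2 * r) - ν - ν * ((1 + r) / 2) / r - 1) := by
          rw [Finset.sum_const, Finset.card_univ, Fintype.card_fin, nsmul_eq_mul]
      _ ≤ _ := Finset.sum_le_sum fun j _ => le_integral_blockTest _ _ hr hν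
        (blockSpikes_blockIndex_self h ν J j)
        fun i hi => blockSpikes_blockIndex_of_ne h ν J j hi

end Prior

/-! ### Asymptotics of the spike scale and of the block bound. -/

section Asymptotics

lemma oracleVar_pos {r : ℝ≥0} (hr : 0 < r) : 0 < oracleVar r := by
  have : (0 : ℝ) < r := hr
  unfold oracleVar
  positivity

lemma lam_sq {m : ℕ} (hm : 1 ≤ m) : lam m ^ 2 = 2 * Real.log m :=
  Real.sq_sqrt (mul_nonneg zero_le_two (Real.log_nonneg (by exact_mod_cast hm)))

lemma tendsto_lam : Tendsto lam atTop atTop :=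
  Real.tendsto_sqrt_atTop.comp
    ((Real.tendsto_log_atTop.comp tendsto_natCast_atTop_atTop).const_mul_atTop zero_lt_two)

lemma spikeScale_nonneg (r : ℝ≥0) {m : ℕ} (h : 1 ≤ lam m) : 0 ≤ spikeScale r m := by
  have := Real.log_le_sub_one_of_pos (zero_lt_one.trans_le h)
  exact mul_nonneg (Real.sqrt_nonneg _) (by linarith)

/-- The oracle variance cancels 1 + 1/r, leaving (λ - log λ)² ≤ λ² = 2 log m; λ ≥ 1 ensures 0 ≤ log
λ ≤ λ. -/
lemma spikeScale_sq_mul_le_log {r : ℝ≥0} (hr : 0 < r) {m : ℕ} (hm : 1 ≤ m) (h : 1 ≤ lam m) :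
    spikeScale r m ^ 2 * (1 + (r : ℝ)⁻¹) / 2 ≤ Real.log m := by
  have hr' : (0 : ℝ) < r := hr
  have h1 := Real.log_le_sub_one_of_pos (zero_lt_one.trans_le h)
  have h2 := Real.log_nonneg h
  have h3 : spikeScale r m ^ 2 * (1 + (r : ℝ)⁻¹) = (lam m - Real.log (lam m)) ^ 2 := by
    rw [spikeScale, mul_pow, Real.sq_sqrt (oracleVar_pos hr).le, oracleVar]
    field_simp
  have h4 : (lam m - Real.log (lam m)) ^ 2 ≤ lam m ^ 2 :=
    pow_le_pow_left₀ (by linarith) (by linarith) 2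
  rw [h3]
  linarith [lam_sq hm]

lemma tendsto_spikeScale_div_lam (r : ℝ≥0) :
    Tendsto (fun m => spikeScale r m / lam m) atTop (𝓝 (Real.sqrt (oracleVar r))) := by
  have h1 : Tendsto (fun m => Real.log (lam m) / lam m) atTop (𝓝 0) :=
    (Real.isLittleO_log_id_atTop.tendsto_div_nhds_zero).comp tendsto_lam
  have h2 := (h1.const_sub 1).const_mul (Real.sqrt (oracleVar r))
  rw [sub_zero, mul_one] at h2
  refine h2.congr' ?_
  filter_upwards [tendsto_lam.eventually_gt_atTop 0] with m hm
  rw [spikeScale]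
  field_simp

/-- The lower bound for the Bayes risk of one block is asymptotically `(1 + r)⁻¹ log m`. -/
lemma tendsto_blockBound_div_log {r : ℝ≥0} (hr : 0 < r) :
    Tendsto (fun m : ℕ => (spikeScale r m ^ 2 / (2 * r) - spikeScale r m -
      spikeScale r m * ((1 + r) / 2) / r - 1) * (1 + r) / Real.log m) atTop (𝓝 1) := by
  have hr' : (0 : ℝ) < r := hr
  have h1 := tendsto_spikeScale_div_lam r
  have h2 : Tendsto (fun m => (lam m)⁻¹) atTop (𝓝 0) := tendsto_inv_atTop_zero.comp tendsto_lam
  -- The bound is divided by λ²; the factor 2 comes from log m = λ²/2.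
  have h3 := ((((h1.pow 2).div_const (2 * r)).sub
    ((h1.mul h2).mul_const (1 + (1 + (r : ℝ)) / 2 / r))).sub (h2.pow 2)).const_mul
    (2 * (1 + (r : ℝ)))
  have hlim : 2 * (1 + (r : ℝ)) * (Real.sqrt (oracleVar r) ^ 2 / (2 * r) -
      Real.sqrt (oracleVar r) * 0 * (1 + (1 + (r : ℝ)) / 2 / r) - 0 ^ 2) = 1 := by
    rw [Real.sq_sqrt (oracleVar_pos hr).le, oracleVar]
    field_simp
    ring
  rw [hlim] at h3
  refine h3.congr' ?_
  filter_upwards [tendsto_lam.eventually_gt_atTop 0, eventually_ge_atTop 1] with m hm hm1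
  have h4 : Real.log m = lam m ^ 2 / 2 := by rw [lam_sq hm1]; ring
  rw [h4]
  field_simp
  ring

/-- As ⌊x⌋/x → 1, the two logarithms differ by o(1), so block length m may be traded for n/s. -/
lemma tendsto_log_floor_div_log :
    Tendsto (fun x : ℝ => Real.log ⌊x⌋₊ / Real.log x) atTop (𝓝 1) := by
  have h1 : Tendsto (fun x : ℝ => Real.log ((⌊x⌋₊ : ℝ) / x)) atTop (𝓝 0) := by
    have := (Real.continuousAt_log one_ne_zero).tendsto.comp
      (tendsto_nat_floor_div_atTop (R := ℝ))
    rwa [Real.log_one] at this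
  have h2 := (h1.div_atTop Real.tendsto_log_atTop).add_const 1
  rw [zero_add] at h2
  refine h2.congr' ?_
  filter_upwards [eventually_gt_atTop 1] with x hx
  have hf : ((⌊x⌋₊ : ℕ) : ℝ) ≠ 0 := by
    exact_mod_cast (Nat.floor_pos.2 hx.le).ne'
  have hl := (Real.log_pos hx).ne'
  rw [Real.log_div hf (by linarith)]
  field_simp
  ring

end Asymptotics

end SparsePrediction

/-! ### Assembly of the theorem. -/

theorem theorem5 (r : ℝ≥0) (hr : 0 < r) (s : ℕ → ℕ)
    (hs : ∀ᶠ n in atTop, 1 ≤ s n)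
    (hsn : Tendsto (fun n : ℕ => (s n : ℝ) / (n : ℝ)) atTop (𝓝 0)) :
    (∀ n : ℕ, 1 ≤ s n → 2 * s n ≤ n →
      SparsePrediction.bayesRisk r (SparsePrediction.blocksPrior r n (s n)) ≤
        SparsePrediction.minimaxRisk r (SparsePrediction.sparseSet n (s n))) ∧
    ∃ ε : ℕ → ℝ, Tendsto ε atTop (𝓝 0) ∧ ∀ᶠ n : ℕ in atTop,
      ENNReal.ofReal
          ((1 - ε n) * ((1 + (r : ℝ))⁻¹ * (s n : ℝ) * Real.log ((n : ℝ) / (s n : ℝ)))) ≤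
        SparsePrediction.bayesRisk r (SparsePrediction.blocksPrior r n (s n)) := by
  open SparsePrediction in
  have hr' : (0 : ℝ) < r := hr
  refine ⟨fun n h1 h2 => bayesRisk_blocksPrior_le_minimaxRisk r
    (Nat.div_pos (by omega) h1).ne', ?_⟩
  have hx : Tendsto (fun n : ℕ => (n : ℝ) / s n) atTop atTop := by
    have : Tendsto (fun n : ℕ => (s n : ℝ) / (n : ℝ)) atTop (𝓝[>] 0) := by
      refine tendsto_nhdsWithin_iff.2 ⟨hsn, ?_⟩
      filter_upwards [hs, eventually_ge_atTop 1] with n h1 h2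
      have h1' : (0 : ℝ) < s n := by exact_mod_cast h1
      have h2' : (0 : ℝ) < n := by exact_mod_cast h2
      exact div_pos h1' h2'
    exact (tendsto_inv_nhdsGT_zero.comp this).congr fun n => inv_div _ _
  have hm : Tendsto (fun n : ℕ => n / s n) atTop atTop :=
    (tendsto_nat_floor_atTop.comp hx).congr fun n => Nat.floor_div_eq_div n (s n)
  have hlog : Tendsto (fun n : ℕ => Real.log (n / s n : ℕ) / Real.log ((n : ℝ) / s n)) atTop
      (𝓝 1) :=
    (tendsto_log_floor_div_log.comp hx).congr fun n => by
      rw [Function.comp_apply, Nat.floor_div_eq_div]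
  set F : ℕ → ℝ := fun m => spikeScale r m ^ 2 / (2 * r) - spikeScale r m -
    spikeScale r m * ((1 + r) / 2) / r - 1 with hF
  -- This ε makes the claimed bound equal to the nonasymptotic one, so only ε → 0 needs proof.
  refine ⟨fun n => 1 - F (n / s n) * (1 + r) / Real.log ((n : ℝ) / s n), ?_, ?_⟩
  · have h := (((tendsto_blockBound_div_log hr).comp hm).mul hlog).const_sub 1
    rw [mul_one, sub_self] at h
    refine h.congr' ?_
    filter_upwards [hm.eventually_gt_atTop 1] with n hn
    have : Real.log (n / s n : ℕ) ≠ 0 := (Real.log_pos (by exact_mod_cast hn)).ne'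
    simp only [Function.comp_apply, hF]
    rw [div_mul_div_cancel₀ this]
  · filter_upwards [hm.eventually_ge_atTop 1, hx.eventually_gt_atTop 1,
      (tendsto_lam.comp hm).eventually_ge_atTop 1] with n h1 h2 h3
    refine le_trans (ENNReal.ofReal_le_ofReal (le_of_eq ?_))
      (le_bayesRisk_blocksPrior hr (Nat.pos_iff_ne_zero.1 h1) (spikeScale_nonneg r h3)
        (spikeScale_sq_mul_le_log hr h1 h3))
    have := (Real.log_pos h2).ne'
    rw [sub_sub_cancel]
    simp only [hF]
    generalize Real.log ((n : ℝ) / s n) = l at *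
    generalize spikeScale r (n / s n) ^ 2 / (2 * r) - spikeScale r (n / s n) -
      spikeScale r (n / s n) * ((1 + r) / 2) / r - 1 = a
    field_simp
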